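/- Let $n\ge 0$. A rook of size $n$ is an $n\times n$ matrix with entries in $\{0,1\}$ having at most one nonzero entry in each row and each column; it is encoded by the vector $(r_1,\dots,r_n)$, where $r_j$ is the index of the row containing the $1$ of column $j$, and $r_j=0$ if column $j$ is zero. Let $1_n=(1,2,\dots,n)$ be the identity rook. Consider the operators, written on the right, on the set of rooks of size $n$ given by $$(r_1,\dots,r_n)\cdot\pi_0=(0,r_2,\dots,r_n)$$ and, for $1\le i\le n-1$, by letting $(r_1,\dots,r_n)\cdot\pi_i$ be the result of exchanging $r_i$ and $r_{i+1}$ if $r_i<r_{i+1}$, and $(r_1,\dots,r_n)$ itself otherwise. The $0$-rook monoid $R_n^0$ is the monoid of functions on the set of rooks of size $n$ generated by $\pi_0,\dots,\pi_{n-1}$, where $xy$ means first $x$, then $y$. For a subset $T=\{t_1<\dots<t_p\}$ of $\{0,\dots,n-1\}$, let $C(T)=(t_1,t_2-t_1,\dots,t_p-t_{p-1},n-t_p)$, with $C(\emptyset)=(n)$. Then: 1. $R_n^0$ has exactly $2^n$ idempotents. 2. For every $S\subseteq\{0,\dots,n-1\}$ the parabolic submonoid $\langle \pi_i : i\in S\rangle$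 of $R_n^0$ has a unique zero $\pi_S$, and the idempotents of $R_n^0$ are exactly the elements $\pi_S$, for $S\subseteq\{0,\dots,n-1\}$. 3. For every $S\subseteq\{0,\dots,n-1\}$, write $S^c=\{0,\dots,n-1\}\setminus S$ and $C(S^c)=(i_1,\dots,i_\ell)$. Then $\pi_S$ is the unique element $x$ of $R_n^0$ such that the rook $1_n\cdot x$ is the block-diagonal matrix with diagonal blocks of sizes $i_1,\dots,i_\ell$, the first of which is zero (it has size $0$ when $0\notin S$), while every other block is the anti-diagonal matrix of ones. -/

import Mathlib

/-- A rook of size `n`, encoded by its rook vector: the `j`-th coordinate is `0` if the `j`-th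
column of the rook matrix is zero, and otherwise the index (in `{1, …, n}`) of the row that
contains the `1` of that column.  Nonzero values are therefore not repeated. -/
def Rook (n : ℕ) : Type :=
  {r : Fin n → Fin (n + 1) // ∀ i j, r i = r j → r i ≠ 0 → i = j}

namespace Rook

/-- The identity rook `1_n = 1 2 … n`. -/
def one (n : ℕ) : Rook n :=
  ⟨fun i => i.succ, fun i j h _ => Fin.succ_injective n h⟩

/-- The rook matrix of a rook vector. -/
def toMatrix {n : ℕ} (r : Rook n) : Matrix (Fin n) (Fin n) ℕ :=
  Matrix.of fun a b => if r.1 b = a.succ then 1 else 0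

/-- Replace the entry in position `i` by `0`. -/
def kill {n : ℕ} (i : Fin n) (r : Rook n) : Rook n :=
  ⟨Function.update r.1 i 0, by
    intro a b hab ha
    have hai : a ≠ i := by
      rintro rfl
      simp at ha
    rw [Function.update_of_ne hai] at hab ha
    have hbi : b ≠ i := by
      rintro rfl
      rw [Function.update_self] at hab
      exact ha hab
    rw [Function.update_of_ne hbi] at hab
    exact r.2 a b hab ha⟩

/-- Exchange the entries in positions `i` and `j`. -/
def swap {n : ℕ} (i j : Fin n) (r : Rook n) : Rook n :=
  ⟨r.1 ∘ Equiv.swap i j, fun _ _ hab ha =>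
    (Equiv.swap i j).injective (r.2 _ _ hab ha)⟩

/-- The position just before position `i` (only used for `i ≠ 0`). -/
def prev {n : ℕ} (i : Fin n) : Fin n :=
  ⟨i.val - 1, lt_of_le_of_lt (Nat.sub_le _ _) i.isLt⟩

/-- The operators `r ↦ r · π_i` for `0 ≤ i ≤ n - 1`: the operator `π_0` replaces the first entry
`r_1` by `0`; for `i ≥ 1` the operator `π_i` exchanges the entries `r_i` and `r_{i+1}` if
`r_i < r_{i+1}`, and fixes `r` otherwise.  (Positions are counted from `0` in the code, so that
`r_i` and `r_{i+1}` are `r.1 (prev i)` and `r.1 i`.) -/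
def pi {n : ℕ} (i : Fin n) (r : Rook n) : Rook n :=
  if i.val = 0 then kill i r
  else if r.1 (prev i) < r.1 i then swap (prev i) i r
  else r

end Rook

/-- The `0`-rook monoid `R_n^0`: the monoid of functions on rooks generated by
`π_0, …, π_{n-1}`.  Functions act on the right, so `x * y` means first `x`, then `y`;
this is the reason for the opposite of the monoid of endofunctions. -/
def ZeroRookMonoid (n : ℕ) : Submonoid (Function.End (Rook n))ᵐᵒᵖ :=
  Submonoid.closure (Set.range fun i : Fin n => MulOpposite.op (Rook.pi i : Function.End (Rook n)))

namespace ZeroRookMonoid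

/-- The right action `r · x` of `x ∈ R_n^0` on a rook `r`. -/
def act {n : ℕ} (r : Rook n) (x : ZeroRookMonoid n) : Rook n :=
  (MulOpposite.unop x.1 : Rook n → Rook n) r

/-- The generator `π_i` of `R_n^0`. -/
def gen {n : ℕ} (i : Fin n) : ZeroRookMonoid n :=
  ⟨MulOpposite.op (Rook.pi i : Function.End (Rook n)),
    Submonoid.subset_closure (Set.mem_range_self i)⟩

/-- The parabolic submonoid generated by the `π_i` with `i ∈ S`. -/
def parabolic {n : ℕ} (S : Finset (Fin n)) : Submonoid (ZeroRookMonoid n) :=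
  Submonoid.closure (gen '' (S : Set (Fin n)))

end ZeroRookMonoid

/-- `z` is a (two-sided) zero of the submonoid `P`. -/
def IsZeroOf {M : Type*} [Monoid M] (P : Submonoid M) (z : M) : Prop :=
  z ∈ P ∧ ∀ x ∈ P, x * z = z ∧ z * x = z

/-- The extended composition `C(T) = (t_1, t_2 - t_1, …, t_p - t_{p-1}, n - t_p)` of `n` attached
to a subset `T = {t_1 < … < t_p}` of `{0, …, n-1}`.  Its first part is `0` exactly if `0 ∈ T`
or `n = 0`. -/
def extComposition {n : ℕ} (T : Finset (Fin n)) : List ℕ :=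
  let t : List ℕ := (T.sort (· ≤ ·)).map Fin.val
  List.zipWith (fun b a => b - a) (t ++ [n]) (0 :: t)

/-- Let `I = (i_0, …, i_ℓ)` be a list of sizes.  Rows `a` and columns `b`, counted from `0`,
lie in the block of index `k` if they are in `[o, o + i_k)` with `o = i_0 + … + i_{k-1}`.
The matrix is block diagonal for these blocks; the first block (`k = 0`) is zero, and every
other block is anti-diagonal, with ones in the places `(a, b)` where
`(a - o) + (b - o) = i_k - 1`. -/
def antiBlockMatrix (n : ℕ) (I : List ℕ) : Matrix (Fin n) (Fin n) ℕ :=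
  open Classical in
  Matrix.of fun a b =>
    if ∃ k : Fin I.length, k.val ≠ 0 ∧
        (I.take k.val).sum ≤ a.val ∧ (I.take k.val).sum ≤ b.val ∧
        a.val + b.val + 1 = 2 * (I.take k.val).sum + I.get k
    then 1 else 0

/-!
The proof rests on two facts about the action of `R_n^0` on rooks.

*The weight.* Every `π_i` either fixes a rook `r` or strictly decreases `∑ p · r_p`
(`Rook.weight_pi`).  Hence the monoid is `R`-trivial: `e * x * y = e` implies `e * x = e`
(`ZeroRookMonoid.mul_eq_of_mul_mul_eq`).

*Faithfulness at the identity.* An element `x` is determined by the rook `1_n · x`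
(`ZeroRookMonoid.act_one_injective`).  The transposes of the `π_i` act on the values of a rook
instead of its positions (`Rook.killOne`, `Rook.piVal`).  They commute with the `π_i`, and they
generate every rook from `1_n`: a rook other than `1_n` is the image, under one of them, of a
heavier rook (`Rook.exists_heavier`).  So if `x` and `y` agree at `1_n`, they agree everywhere.

An element of minimal weight at `1_n` in the parabolic submonoid of `S` is fixed on the right by
`π_i`, `i ∈ S`.  For such an element `z`, the rook `1_n · z` is split at each cut outside `S` (as
every element of the submonoid respects these cuts) and weakly decreasing inside the blocks, with
first entry `0` if `0 ∈ S`.  This forces the announced block-diagonal matrix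
(`Rook.IsSortedBy.toMatrix_eq`).  By faithfulness, `z` is the only right-fixed element, and as
`x * z` is right-fixed too, `z` is a two-sided zero.

Finally, let `e` be idempotent and `S` the set of the `i` with `e * π_i = e`.  By `R`-triviality
each letter of a word for `e` lies in `S`, so `e` belongs to the parabolic submonoid of `S`.  Its
zero `z` then satisfies `e = e * z = z`.  Since `i ∈ S` if and only if `π_S * π_i = π_S`, the `π_S`
are distinct, which gives the count `2 ^ n`.
-/

/-! ### The generators on rook vectors -/

namespace Rook

variable {n : ℕ}

@[ext]
theorem ext {r s : Rook n} (h : ∀ p, (r.1 p).val = (s.1 p).val) : r = s :=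
  Subtype.ext (funext fun p => Fin.ext (h p))

theorem eq_of_val_eq (r : Rook n) {p q : Fin n} (h : (r.1 p).val = (r.1 q).val)
    (h0 : (r.1 p).val ≠ 0) : p = q :=
  r.2 p q (Fin.ext h) fun h' => h0 (by simp [h'])

theorem kill_val (i : Fin n) (r : Rook n) (p : Fin n) :
    ((kill i r).1 p).val = if p = i then 0 else (r.1 p).val := by
  simp only [kill, Function.update_apply]
  split_ifs <;> simp

theorem swap_val (i j : Fin n) (r : Rook n) (p : Fin n) :
    ((swap i j r).1 p).val =
      if p = i then (r.1 j).val else if p = j then (r.1 i).val else (r.1 p).val := by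
  simp only [swap, Function.comp_apply, Equiv.swap_apply_def]
  split_ifs <;> rfl

theorem prev_val (i : Fin n) : (prev i).val = i.val - 1 := rfl

theorem pi_of_eq_zero {i : Fin n} (h : i.val = 0) (r : Rook n) : pi i r = kill i r := if_pos h

theorem pi_of_lt {i : Fin n} (h : i.val ≠ 0) {r : Rook n} (h' : (r.1 (prev i)).val < (r.1 i).val) :
    pi i r = swap (prev i) i r := by
  rw [pi, if_neg h, if_pos (Fin.lt_def.2 h')]

theorem pi_of_not_lt {i : Fin n} (h : i.val ≠ 0) {r : Rook n}
    (h' : ¬ (r.1 (prev i)).val < (r.1 i).val) : pi i r = r := by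
  rw [pi, if_neg h, if_neg (fun hlt => h' (Fin.lt_def.1 hlt))]

theorem pi_eq_self_iff (i : Fin n) (r : Rook n) :
    pi i r = r ↔ (i.val = 0 → (r.1 i).val = 0) ∧
      (i.val ≠ 0 → (r.1 i).val ≤ (r.1 (prev i)).val) := by
  by_cases h : i.val = 0
  · rw [pi_of_eq_zero h]
    constructor
    · intro hk
      have := kill_val i r i
      rw [hk] at this
      simp_all
    · intro hk
      ext p
      rw [kill_val]
      split_ifs with hp
      · rw [hp, hk.1 h]
      · rfl
  · by_cases h' : (r.1 (prev i)).val < (r.1 i).val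
    · rw [pi_of_lt h h']
      constructor
      · intro hs
        have := swap_val (prev i) i r (prev i)
        rw [hs, if_pos rfl] at this
        omega
      · intro hs
        have := hs.2 h
        omega
    · rw [pi_of_not_lt h h']
      exact ⟨fun _ => ⟨fun h0 => absurd h0 h, fun _ => not_lt.1 h'⟩, fun _ => rfl⟩

/-! ### The weight of a rook -/

/-- The weight `∑ p · r_p` of a rook, positions `p` being counted from `1`.  It is invariant under
transposition of the rook matrix, so it controls operators on positions and on values alike. -/
def weight (r : Rook n) : ℕ := ∑ p : Fin n, (p.val + 1) * (r.1 p).val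

theorem weight_lt_of_le_of_ne {r s : Rook n} (hle : ∀ p, (r.1 p).val ≤ (s.1 p).val) (hne : r ≠ s) :
    r.weight < s.weight := by
  have : ∃ p, (r.1 p).val < (s.1 p).val := by
    by_contra! h
    exact hne (ext fun p => le_antisymm (hle p) (h p))
  obtain ⟨p, hp⟩ := this
  exact Finset.sum_lt_sum (fun q _ => Nat.mul_le_mul_left _ (hle q))
    ⟨p, Finset.mem_univ p, Nat.mul_lt_mul_of_pos_left hp (Nat.succ_pos _)⟩

theorem weight_swap_lt {p q : Fin n} (hpq : p < q) {r : Rook n}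
    (h : (r.1 p).val < (r.1 q).val) : (swap p q r).weight < r.weight := by
  have hq : q ∈ (Finset.univ : Finset (Fin n)).erase p := by simp [hpq.ne']
  have key : ∀ s : Rook n, s.weight = (p.val + 1) * (s.1 p).val + ((q.val + 1) * (s.1 q).val +
      ∑ k ∈ (Finset.univ.erase p).erase q, (k.val + 1) * (s.1 k).val) := fun s => by
    rw [weight, ← Finset.add_sum_erase _ _ (Finset.mem_univ p), ← Finset.add_sum_erase _ _ hq]
  rw [key, key r, swap_val, swap_val, if_pos rfl, if_neg hpq.ne', if_pos rfl]
  have hrest : ∑ k ∈ (Finset.univ.erase p).erase q, (k.val + 1) * ((swap p q r).1 k).val =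
      ∑ k ∈ (Finset.univ.erase p).erase q, (k.val + 1) * (r.1 k).val := by
    refine Finset.sum_congr rfl fun k hk => ?_
    simp only [Finset.mem_erase] at hk
    rw [swap_val, if_neg hk.2.1, if_neg hk.1]
  rw [hrest]
  have hpq' : p.val < q.val := hpq
  nlinarith

theorem weight_pi (i : Fin n) (r : Rook n) : pi i r = r ∨ (pi i r).weight < r.weight := by
  by_cases h : i.val = 0
  · rw [pi_of_eq_zero h]
    refine or_iff_not_imp_left.2 fun hne => weight_lt_of_le_of_ne (fun p => ?_) hne
    rw [kill_val]
    split_ifs <;> simp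
  · by_cases h' : (r.1 (prev i)).val < (r.1 i).val
    · rw [pi_of_lt h h']
      refine Or.inr (weight_swap_lt ?_ h')
      rw [Fin.lt_def, prev_val]
      omega
    · exact Or.inl (pi_of_not_lt h h')

/-! ### Operators on values and their commutation with the generators -/

/-- Replace the value `1` by `0`: the transposed analogue of `π_0`. -/
def killOne (r : Rook n) : Rook n :=
  ⟨fun p => if (r.1 p).val = 1 then 0 else r.1 p, fun p q h h0 => by
    dsimp only at h h0
    split_ifs at h h0 with h1 h2
    · exact absurd rfl h0
    · exact absurd rfl h0
    · exact absurd h h0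
    · exact r.2 p q h h0⟩

theorem killOne_val (r : Rook n) (p : Fin n) :
    ((killOne r).1 p).val = if (r.1 p).val = 1 then 0 else (r.1 p).val := by
  simp only [killOne]
  split_ifs <;> simp

theorem killOne_pi (i : Fin n) (r : Rook n) : killOne (pi i r) = pi i (killOne r) := by
  by_cases h : i.val = 0
  · rw [pi_of_eq_zero h, pi_of_eq_zero h]
    ext p
    simp only [killOne_val, kill_val]
    grind
  · have hp : prev i ≠ i := fun hp => by
      have := congrArg Fin.val hp
      rw [prev_val] at this
      omega
    by_cases h' : (r.1 (prev i)).val < (r.1 i).val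
    · rw [pi_of_lt h h']
      by_cases h'' : ((killOne r).1 (prev i)).val < ((killOne r).1 i).val
      · rw [pi_of_lt h h'']
        ext p
        simp only [killOne_val, swap_val]
        grind
      · rw [pi_of_not_lt h h'']
        ext p
        simp only [killOne_val, swap_val] at h'' ⊢
        grind
    · rw [pi_of_not_lt h h', pi_of_not_lt h]
      simp only [killOne_val]
      grind

/-- Exchange the values `u` and `u + 1`, for `u ≠ 0`. -/
def swapVal (u : Fin n) (hu : u.val ≠ 0) (r : Rook n) : Rook n :=
  ⟨fun p => Equiv.swap u.castSucc u.succ (r.1 p), fun p q h h0 => by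
    refine r.2 p q ((Equiv.swap _ _).injective h) fun hp => h0 ?_
    dsimp only
    rw [hp]
    refine Equiv.swap_apply_of_ne_of_ne (fun h => hu ?_) (Fin.succ_ne_zero u).symm
    simpa using (congrArg Fin.val h).symm⟩

theorem swapVal_val (u : Fin n) (hu : u.val ≠ 0) (r : Rook n) (p : Fin n) :
    ((swapVal u hu r).1 p).val = if (r.1 p).val = u.val then u.val + 1
      else if (r.1 p).val = u.val + 1 then u.val else (r.1 p).val := by
  simp only [swapVal, Equiv.swap_apply_def, Fin.ext_iff]
  split_ifs <;> simp_all

/-- The value `u + 1` occurs in `r`, and `u`, if it occurs, stands before it.  This is the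
inequality `r_u < r_{u+1}` for the transposed rook. -/
def ValLT (u : Fin n) (r : Rook n) : Prop :=
  ∃ b, (r.1 b).val = u.val + 1 ∧ ∀ a, (r.1 a).val = u.val → a < b

open Classical in
/-- The transposed analogue of `π_u` for `u ≥ 1`: exchange the values `u` and `u + 1` if `u` is
absent or stands before `u + 1`. -/
noncomputable def piVal (u : Fin n) (hu : u.val ≠ 0) (r : Rook n) : Rook n :=
  if ValLT u r then swapVal u hu r else r

theorem piVal_pi_zero (u : Fin n) (hu : u.val ≠ 0) {i : Fin n} (h : i.val = 0) (r : Rook n) :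
    piVal u hu (pi i r) = pi i (piVal u hu r) := by
  rw [pi_of_eq_zero h, pi_of_eq_zero h]
  have hmin : ∀ p : Fin n, ¬ p < i := fun p hp => by
    rw [Fin.lt_def] at hp
    omega
  have hinj := @eq_of_val_eq _ r
  unfold piVal
  split_ifs with h1 h2 h2
  · ext p
    simp only [kill_val, swapVal_val]
    grind
  · obtain ⟨b, hb, hb'⟩ := h1
    rw [kill_val] at hb
    have hbi : b ≠ i := by grind
    rw [if_neg hbi] at hb
    -- the value `u` of `r` cannot stand behind `u + 1`, and at position `i` it is before it
    refine absurd ⟨b, hb, fun a ha => ?_⟩ h2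
    by_cases hai : a = i
    · subst hai
      rw [Fin.lt_def]
      have : b.val ≠ a.val := fun h => hbi (Fin.ext h)
      omega
    · refine hb' a ?_
      rw [kill_val, if_neg hai, ha]
  · obtain ⟨b, hb, hb'⟩ := h2
    -- `u + 1` must have been killed, and then `u` was absent
    have hbi : b = i := by
      by_contra hbi
      refine h1 ⟨b, by rw [kill_val, if_neg hbi, hb], fun a ha => hb' a ?_⟩
      rw [kill_val] at ha
      grind
    subst hbi
    ext p
    simp only [kill_val, swapVal_val]
    grind
  · rfl

/-- Exchanging two neighbouring entries keeps the relative order of `u` and `u + 1`, unless these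
are the two entries. -/
theorem ValLT.swap {u i : Fin n} (h : i.val ≠ 0) {r : Rook n} (hr : ValLT u r)
    (hne : ¬ ((r.1 (prev i)).val = u.val ∧ (r.1 i).val = u.val + 1)) :
    ValLT u (swap (prev i) i r) := by
  obtain ⟨b, hb, hb'⟩ := hr
  have hprev := prev_val i
  have hpi : prev i ≠ i := fun hp => by
    have := congrArg Fin.val hp
    omega
  refine ⟨Equiv.swap (prev i) i b, ?_, fun a ha => ?_⟩
  · rw [swap_val, Equiv.swap_apply_def]
    grind
  · -- exchanging neighbours reverses the order of no other pair of positions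
    have hord : ∀ c d : Fin n, c < d → ¬ (c = prev i ∧ d = i) →
        Equiv.swap (prev i) i c < Equiv.swap (prev i) i d := fun c d hcd hne' => by
      simp only [Equiv.swap_apply_def]
      split_ifs <;> simp only [Fin.lt_def, Fin.ext_iff] at * <;> omega
    have := hord (Equiv.swap (prev i) i a) b (hb' _ ha) ?_
    · rwa [Equiv.swap_apply_self] at this
    · rintro ⟨h1, h2⟩
      refine hne ⟨?_, h2 ▸ hb⟩
      rw [← h1]
      exact ha

theorem swap_swap (p q : Fin n) (r : Rook n) : swap p q (swap p q r) = r := by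
  ext k
  simp only [swap_val]
  grind

theorem piVal_pi (u : Fin n) (hu : u.val ≠ 0) (i : Fin n) (r : Rook n) :
    piVal u hu (pi i r) = pi i (piVal u hu r) := by
  by_cases h : i.val = 0
  · exact piVal_pi_zero u hu h r
  have hprev := prev_val i
  have hpi : prev i ≠ i := fun hp => by
    have := congrArg Fin.val hp
    omega
  have hlt : prev i < i := by
    rw [Fin.lt_def]
    omega
  have hinj := @eq_of_val_eq _ r
  by_cases hA : (r.1 (prev i)).val = u.val ∧ (r.1 i).val = u.val + 1
  · -- both operators exchange the same two entries
    have hv : ValLT u r := ⟨i, hA.2, fun a ha => by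
      rw [hinj (ha.trans hA.1.symm) (by omega)]
      exact hlt⟩
    have hsw : swap (prev i) i r = swapVal u hu r := by
      ext p
      simp only [swap_val, swapVal_val]
      grind
    have hv' : ¬ ValLT u (swap (prev i) i r) := by
      rintro ⟨b, hb, hb'⟩
      have h1 := hb' i
      rw [swap_val] at hb h1
      grind
    rw [pi_of_lt h (by omega), piVal, if_neg hv', piVal, if_pos hv, ← hsw, pi_of_not_lt h]
    simp only [swap_val]
    grind
  -- if the two entries are `u + 1, u`, both operators fix `r`
  by_cases hB : (r.1 (prev i)).val = u.val + 1 ∧ (r.1 i).val = u.val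
  · have hv : ¬ ValLT u r := by
      rintro ⟨b, hb, hb'⟩
      have h1 := hb' i hB.2
      rw [hinj (hb.trans hB.1.symm) (by omega)] at h1
      exact absurd h1 (not_lt.2 hlt.le)
    rw [pi_of_not_lt h (by omega), piVal, if_neg hv, pi_of_not_lt h (by omega)]
  -- otherwise neither operator changes the condition under which the other one acts
  by_cases h' : (r.1 (prev i)).val < (r.1 i).val
  · have h'' : ((swapVal u hu r).1 (prev i)).val < ((swapVal u hu r).1 i).val := by
      simp only [swapVal_val]
      grind
    have hiff : ValLT u (swap (prev i) i r) ↔ ValLT u r := by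
      refine ⟨fun hv => ?_, fun hv => hv.swap h hA⟩
      rw [← swap_swap (prev i) i r]
      refine hv.swap h ?_
      simp only [swap_val]
      grind
    rw [pi_of_lt h h']
    unfold piVal
    by_cases hv : ValLT u r
    · rw [if_pos hv, if_pos (hiff.2 hv), pi_of_lt h h'']
      rfl
    · rw [if_neg hv, if_neg (fun hs => hv (hiff.1 hs)), pi_of_lt h h']
  · rw [pi_of_not_lt h h']
    unfold piVal
    split_ifs
    · rw [pi_of_not_lt h]
      simp only [swapVal_val]
      grind
    · rw [pi_of_not_lt h h']

/-! ### Generating all rooks from the identity by operators on values -/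

theorem one_val (p : Fin n) : ((one n).1 p).val = p.val + 1 := rfl

theorem swapVal_swapVal (u : Fin n) (hu : u.val ≠ 0) (r : Rook n) :
    swapVal u hu (swapVal u hu r) = r := by
  ext k
  simp only [swapVal_val]
  grind

/-- If `u` occurs in `r` and `u + 1` does not occur behind it, then `r` is the image under `piVal`
of a heavier rook. -/
theorem exists_piVal_eq {r : Rook n} (u : Fin n) (hu : u.val ≠ 0) (a : Fin n)
    (ha : (r.1 a).val = u.val) (h : ∀ b, (r.1 b).val = u.val + 1 → b ≤ a) :
    ∃ s : Rook n, r.weight < s.weight ∧ piVal u hu s = r := by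
  have hinj := @eq_of_val_eq _ r
  have hval := swapVal_val u hu r
  refine ⟨swapVal u hu r, ?_, ?_⟩
  · by_cases hb : ∃ b, (r.1 b).val = u.val + 1
    · obtain ⟨b, hb⟩ := hb
      have hba : b < a := lt_of_le_of_ne (h b hb) fun e => by
        rw [e] at hb
        omega
      have hr : r = swap b a (swapVal u hu r) := by
        ext p
        simp only [swap_val, hval]
        grind
      conv_lhs => rw [hr]
      refine weight_swap_lt hba ?_
      simp only [hval]
      grind
    · refine weight_lt_of_le_of_ne (fun p => ?_) fun e => ?_
      · rw [hval]
        grind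
      · have := hval a
        rw [← e, if_pos ha] at this
        omega
  · rw [piVal, if_pos, swapVal_swapVal]
    refine ⟨a, by rw [hval, if_pos ha], fun c hc => ?_⟩
    rw [hval] at hc
    have hc' : (r.1 c).val = u.val + 1 := by grind
    refine lt_of_le_of_ne (h c hc') fun e => ?_
    rw [e] at hc'
    omega

/-- A rook with a zero column and without the value `1` is the image under `killOne` of a heavier
rook. -/
theorem exists_killOne_eq {r : Rook n} (p : Fin n) (hp : (r.1 p).val = 0)
    (h : ∀ q, (r.1 q).val ≠ 1) : ∃ s : Rook n, r.weight < s.weight ∧ killOne s = r := by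
  have hn : 1 < n + 1 := by have := p.isLt; omega
  let s : Rook n := ⟨fun q => if q = p then ⟨1, hn⟩ else r.1 q, fun a b hab h0 => by
    have hinj := @eq_of_val_eq _ r
    have ha := h a
    have hb := h b
    simp only [Fin.ext_iff] at hab h0
    grind⟩
  have hs : ∀ q, (s.1 q).val = if q = p then 1 else (r.1 q).val := fun q => by
    simp only [s]
    split_ifs <;> rfl
  refine ⟨s, weight_lt_of_le_of_ne (fun q => ?_) fun e => ?_, ?_⟩
  · rw [hs]
    grind
  · exact h p (by rw [e, hs, if_pos rfl])
  · ext q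
    have := h q
    rw [killOne_val, hs]
    grind

/-- If every occurring value `u < n` is followed, further right, by `u + 1`, and the value `1`
occurs, then the rook is the identity: the increasing chain of positions leaves no room. -/
theorem eq_one_of_chain {r : Rook n}
    (h : ∀ a, (r.1 a).val ≠ 0 → (r.1 a).val < n → ∃ b, (r.1 b).val = (r.1 a).val + 1 ∧ a < b)
    {p : Fin n} (hp : (r.1 p).val = 1) : r = one n := by
  -- from `a`, the chain climbs to the value `n`, moving right, and there are only `n` positions
  have hle : ∀ k, ∀ a, (r.1 a).val ≠ 0 → (r.1 a).val + k = n → a.val + 1 ≤ (r.1 a).val := by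
    intro k
    induction k with
    | zero => intro a _ ha; have := a.isLt; omega
    | succ k ih =>
      intro a h0 ha
      obtain ⟨b, hb, hab⟩ := h a h0 (by omega)
      have := ih b (by omega) (by omega)
      rw [Fin.lt_def] at hab
      omega
  -- from `p`, the chain reaches every value, moving right at each step
  have hge : ∀ v, v < n → ∃ q : Fin n, (r.1 q).val = v + 1 ∧ v ≤ q.val := by
    intro v
    induction v with
    | zero => exact fun _ => ⟨p, hp, Nat.zero_le _⟩
    | succ v ih =>
      intro hv
      obtain ⟨q, hq, hvq⟩ := ih (by omega)
      obtain ⟨b, hb, hqb⟩ := h q (by omega) (by omega)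
      rw [Fin.lt_def] at hqb
      exact ⟨b, by omega, by omega⟩
  ext q
  obtain ⟨q', hq', hle'⟩ := hge q.val q.isLt
  have := hle (n - (r.1 q').val) q' (by omega) (by have := (r.1 q').isLt; omega)
  have hqq : q' = q := Fin.ext (by omega)
  rw [one_val, ← hqq, hq', hqq]

theorem exists_heavier {r : Rook n} (hr : r ≠ one n) :
    ∃ s : Rook n, r.weight < s.weight ∧
      (killOne s = r ∨ ∃ (u : Fin n) (hu : u.val ≠ 0), piVal u hu s = r) := by
  by_cases h : ∀ a, (r.1 a).val ≠ 0 → (r.1 a).val < n → ∃ b, (r.1 b).val = (r.1 a).val + 1 ∧ a < b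
  · have h1 : ∀ q, (r.1 q).val ≠ 1 := fun q hq => hr (eq_one_of_chain h hq)
    -- without zero columns `r` would be a permutation and the value `1` would occur
    have h0 : ∃ p, (r.1 p).val = 0 := by
      by_contra! h0
      have hlt : ∀ p, (r.1 p).val - 1 < n := fun p => by
        have := (r.1 p).isLt
        have := h0 p
        omega
      have hinj : Function.Injective fun p : Fin n => (⟨(r.1 p).val - 1, hlt p⟩ : Fin n) :=
        fun p q hpq => by
          have h2 := congrArg Fin.val hpq
          have hp := h0 p
          have hq := h0 q
          dsimp only at h2
          exact r.eq_of_val_eq (by omega) hp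
      obtain ⟨p, -⟩ : ∃ p, (r.1 p).val ≠ ((one n).1 p).val := by
        by_contra! h2
        exact hr (ext h2)
      obtain ⟨q, hq⟩ := Finite.injective_iff_surjective.1 hinj ⟨0, p.pos⟩
      have h2 := congrArg Fin.val hq
      have h3 := h0 q
      dsimp only at h2
      exact h1 q (by omega)
    obtain ⟨p, hp⟩ := h0
    obtain ⟨s, hs, hs'⟩ := exists_killOne_eq p hp h1
    exact ⟨s, hs, Or.inl hs'⟩
  · push Not at h
    obtain ⟨a, ha0, han, ha⟩ := h
    obtain ⟨s, hs, hs'⟩ := exists_piVal_eq ⟨(r.1 a).val, han⟩ ha0 a rfl ha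
    exact ⟨s, hs, Or.inr ⟨_, ha0, hs'⟩⟩

theorem weight_le (r : Rook n) : r.weight ≤ ∑ p : Fin n, (p.val + 1) * n :=
  Finset.sum_le_sum fun p _ => Nat.mul_le_mul_left _ (Nat.le_of_lt_succ (r.1 p).isLt)

/-- Every rook arises from the identity by the operators on values. -/
theorem induction_on_values {P : Rook n → Prop} (one : P (one n))
    (killOne : ∀ s, P s → P (killOne s))
    (piVal : ∀ u hu s, P s → P (piVal u hu s)) (r : Rook n) : P r := by
  induction hk : (∑ p : Fin n, (p.val + 1) * n) - r.weight using Nat.strong_induction_on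
    generalizing r with
  | _ k ih =>
    by_cases hr : r = Rook.one n
    · rwa [hr]
    obtain ⟨s, hs, h⟩ := exists_heavier hr
    have hP : P s := ih _ (by have := s.weight_le; omega) s rfl
    rcases h with rfl | ⟨u, hu, rfl⟩
    · exact killOne s hP
    · exact piVal u hu s hP

end Rook

/-! ### Faithfulness at the identity and `R`-triviality -/

namespace ZeroRookMonoid

variable {n : ℕ}

theorem act_mul (r : Rook n) (x y : ZeroRookMonoid n) : act r (x * y) = act (act r x) y := rfl

theorem act_gen (r : Rook n) (i : Fin n) : act r (gen i) = Rook.pi i r := rfl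

theorem ext_act {x y : ZeroRookMonoid n} (h : ∀ r, act r x = act r y) : x = y :=
  Subtype.ext (MulOpposite.unop_injective (funext h))

theorem induction_on_gen {P : ZeroRookMonoid n → Prop} (one : P 1) (gen : ∀ i, P (gen i))
    (mul : ∀ x y, P x → P y → P (x * y)) (x : ZeroRookMonoid n) : P x := by
  obtain ⟨x, hx⟩ := x
  refine Submonoid.closure_induction (motive := fun x hx => P ⟨x, hx⟩) ?_ one
    (fun x y hx hy h h' => mul ⟨x, hx⟩ ⟨y, hy⟩ h h') hx
  rintro _ ⟨i, rfl⟩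
  exact gen i

/-- An operator on rooks that commutes with all `π_i` commutes with the action of the monoid. -/
theorem act_comm {F : Rook n → Rook n} (hF : ∀ i r, F (Rook.pi i r) = Rook.pi i (F r))
    (x : ZeroRookMonoid n) (r : Rook n) : act (F r) x = F (act r x) := by
  induction x using induction_on_gen generalizing r with
  | one => rfl
  | gen i => exact (hF i r).symm
  | mul x y hx hy => rw [act_mul, act_mul, hx, hy]

/-- An element of the monoid is determined by its value at the identity rook, since the operators
on values commute with it and carry the identity rook to every other rook. -/
theorem act_one_injective : Function.Injective fun x : ZeroRookMonoid n => act (Rook.one n) x := by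
  intro x y h
  refine ext_act fun r => ?_
  induction r using Rook.induction_on_values with
  | one => exact h
  | killOne s hs => rw [act_comm Rook.killOne_pi, act_comm Rook.killOne_pi, hs]
  | piVal u hu s hs => rw [act_comm (Rook.piVal_pi u hu), act_comm (Rook.piVal_pi u hu), hs]

theorem weight_act (r : Rook n) (x : ZeroRookMonoid n) :
    act r x = r ∨ (act r x).weight < r.weight := by
  induction x using induction_on_gen generalizing r with
  | one => exact Or.inl rfl
  | gen i => exact Rook.weight_pi i r
  | mul x y hx hy =>
    rw [act_mul]
    rcases hx r with h | h
    · rw [h]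
      exact hy r
    · rcases hy (act r x) with h' | h'
      · exact Or.inr (by rwa [h'])
      · exact Or.inr (h'.trans h)

/-- The monoid is `R`-trivial. -/
theorem mul_eq_of_mul_mul_eq {e x y : ZeroRookMonoid n} (h : e * x * y = e) : e * x = e := by
  refine ext_act fun r => ?_
  rw [act_mul]
  refine (weight_act (act r e) x).resolve_right fun hlt => ?_
  have h' : act (act (act r e) x) y = act r e := by rw [← act_mul, ← act_mul, ← mul_assoc, h]
  rcases weight_act (act (act r e) x) y with h'' | h''
  · rw [h''] at h'
    rw [h'] at hlt
    exact lt_irrefl _ hlt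
  · rw [h'] at h''
    exact lt_asymm hlt h''

/-- If `e * x = e`, then `x` is a product of generators each of which fixes `e` on the right. -/
theorem mem_parabolic_of_mul_eq {e x : ZeroRookMonoid n} {S : Finset (Fin n)}
    (hS : ∀ i, e * gen i = e → i ∈ S) (h : e * x = e) : x ∈ parabolic S := by
  induction x using induction_on_gen with
  | one => exact one_mem _
  | gen i => exact Submonoid.subset_closure ⟨i, hS i h, rfl⟩
  | mul x y hx hy =>
    have hex : e * x = e := mul_eq_of_mul_mul_eq (y := y) (by rw [mul_assoc, h])
    refine mul_mem (hx hex) (hy ?_)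
    rwa [← mul_assoc, hex] at h

theorem mul_eq_of_mem_parabolic {e x : ZeroRookMonoid n} {S : Finset (Fin n)}
    (h : ∀ i ∈ S, e * gen i = e) (hx : x ∈ parabolic S) : e * x = e := by
  induction hx using Submonoid.closure_induction with
  | mem x hx =>
    obtain ⟨i, hi, rfl⟩ := hx
    exact h i hi
  | one => exact mul_one e
  | mul x y _ _ hx hy => rw [← mul_assoc, hx, hy]

/-- An element of minimal weight in a parabolic submonoid is fixed on the right by it. -/
theorem exists_right_fixed (S : Finset (Fin n)) :
    ∃ z ∈ parabolic S, ∀ i ∈ S, z * gen i = z := by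
  obtain ⟨z, hz, hmin⟩ := exists_minimalFor_of_wellFoundedLT (· ∈ parabolic S)
    (fun x => (act (Rook.one n) x).weight) ⟨1, one_mem _⟩
  refine ⟨z, hz, fun i hi => act_one_injective ?_⟩
  dsimp only
  rw [act_mul]
  refine (weight_act _ (gen i)).resolve_right fun hlt => ?_
  have := hmin (mul_mem hz (Submonoid.subset_closure ⟨i, hi, rfl⟩)) hlt.le
  exact absurd hlt (not_lt.2 this)

end ZeroRookMonoid

/-! ### Rooks fixed by a parabolic submonoid -/

namespace Rook

variable {n : ℕ}

/-- The cut at `i` splits the rook: the positions before `i` hold only values `≤ i` and the other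
positions only values `> i`. -/
def SplitAt (i : Fin n) (r : Rook n) : Prop :=
  ∀ p : Fin n, p.val < i.val ↔ (r.1 p).val ≤ i.val

theorem splitAt_one (i : Fin n) : SplitAt i (one n) := fun p => by
  rw [one_val]
  exact Nat.lt_iff_add_one_le

theorem SplitAt.pi {i j : Fin n} (hij : i ≠ j) {r : Rook n} (h : SplitAt i r) :
    SplitAt i (pi j r) := by
  have hij' : i.val ≠ j.val := fun e => hij (Fin.ext e)
  intro p
  have hp := h p
  by_cases hj : j.val = 0
  · rw [pi_of_eq_zero hj, kill_val]
    split_ifs with hpj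
    · subst hpj
      omega
    · exact hp
  · by_cases hlt : (r.1 (prev j)).val < (r.1 j).val
    · have h1 := h (prev j)
      have h2 := h j
      rw [prev_val] at h1
      rw [pi_of_lt hj hlt, swap_val]
      split_ifs with hp1 hp2
      · rw [hp1, prev_val]
        omega
      · rw [hp2]
        omega
      · exact hp
    · rw [pi_of_not_lt hj hlt]
      exact hp

/-- A cut that splits the rook is an ascent there, or a nonzero first entry if `i = 0`. -/
theorem SplitAt.pi_ne {i : Fin n} {r : Rook n} (h : SplitAt i r) : Rook.pi i r ≠ r := by
  rw [Ne, pi_eq_self_iff]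
  rintro ⟨h0, h1⟩
  have hi := h i
  have hp := h (prev i)
  rw [prev_val] at hp
  by_cases hz : i.val = 0
  · have := h0 hz
    omega
  · have := h1 hz
    omega

/-- The rook is split at the cuts outside `S` and fixed by the `π_i` with `i ∈ S`.  These are the
properties of `1_n · π_S` from which its matrix is computed. -/
structure IsSortedBy (S : Finset (Fin n)) (r : Rook n) : Prop where
  splitAt : ∀ i ∉ S, SplitAt i r
  fixed : ∀ i ∈ S, pi i r = r

/-- The interval `[o, e)` of positions is delimited by consecutive elements of `T ∪ {n}`, with
`o ∈ T`. -/
structure IsBlock (T : Finset (Fin n)) (o : Fin n) (e : ℕ) : Prop where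
  left_mem : o ∈ T
  lt : o.val < e
  le : e ≤ n
  right_mem : ∀ i : Fin n, i.val = e → i ∈ T
  notMem : ∀ i : Fin n, o.val < i.val → i.val < e → i ∉ T

theorem exists_isBlock {T : Finset (Fin n)} {b i : Fin n} (hi : i ∈ T) (hib : i ≤ b) :
    ∃ o e, IsBlock T o e ∧ o ≤ b ∧ b.val < e := by
  classical
  have hne : (T.filter (· ≤ b)).Nonempty := ⟨i, by simp [hi, hib]⟩
  have hex : ∃ e, b.val < e ∧ e ≤ n ∧ ∀ i : Fin n, i.val = e → i ∈ T :=
    ⟨n, b.isLt, le_rfl, fun i hi => absurd hi i.isLt.ne⟩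
  have ho := Finset.max'_mem _ hne
  rw [Finset.mem_filter] at ho
  obtain ⟨he1, he2, he3⟩ := Nat.find_spec hex
  refine ⟨(T.filter (· ≤ b)).max' hne, Nat.find hex, ⟨ho.1, ?_, he2, he3, ?_⟩, ho.2, he1⟩
  · exact lt_of_le_of_lt (Fin.le_def.1 ho.2) he1
  · intro j hoj hje hj
    rcases le_or_gt j b with hjb | hbj
    · have := Finset.le_max' (T.filter (· ≤ b)) j (by simp [hj, hjb])
      rw [Fin.le_def] at this
      omega
    · refine Nat.find_min hex hje ⟨hbj, j.isLt.le, fun k hk => ?_⟩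
      rwa [Fin.ext hk]

namespace IsSortedBy

variable {S : Finset (Fin n)} {r : Rook n}

theorem eq_zero (h : IsSortedBy S r) : ∀ k, ∀ b : Fin n, b.val = k → (∀ i ≤ b, i ∈ S) →
    (r.1 b).val = 0 := by
  intro k
  induction k with
  | zero => exact fun b hb hS => ((pi_eq_self_iff b r).1 (h.fixed b (hS b le_rfl))).1 hb
  | succ k ih =>
    intro b hb hS
    have h1 := ((pi_eq_self_iff b r).1 (h.fixed b (hS b le_rfl))).2 (by omega)
    have hpb := prev_val b
    have h2 := ih (prev b) (by omega) fun i hi => hS i <| by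
      rw [Fin.le_def] at hi ⊢
      omega
    omega

/-- Inside a block the values decrease strictly and lie in `(o, e]`, so they are exactly
`e, e - 1, …, o + 1`. -/
theorem val_add (h : IsSortedBy S r) {o : Fin n} {e : ℕ} (hb : IsBlock Sᶜ o e) {p : Fin n}
    (hop : o ≤ p) (hpe : p.val < e) : (r.1 p).val + p.val = o.val + e := by
  have hoS := Finset.mem_compl.1 hb.left_mem
  have hlow : ∀ q : Fin n, o.val ≤ q.val → o.val < (r.1 q).val := fun q hq => by
    have := h.splitAt o hoS q
    omega
  have hstep : ∀ q : Fin n, o.val < q.val → q.val < e →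
      (r.1 q).val < (r.1 (prev q)).val := fun q hoq hqe => by
    have hqS : q ∈ S := by
      have := hb.notMem q hoq hqe
      simpa using this
    have h1 := ((pi_eq_self_iff q r).1 (h.fixed q hqS)).2 (by omega)
    refine lt_of_le_of_ne h1 fun heq => ?_
    have hq := congrArg Fin.val (r.eq_of_val_eq heq (by have := hlow q hoq.le; omega))
    rw [prev_val] at hq
    omega
  have hupper : ∀ k, ∀ q : Fin n, q.val = o.val + k → q.val < e → (r.1 q).val + k ≤ e := by
    intro k
    induction k with
    | zero =>
      intro q hq hqe
      rcases hb.le.lt_or_eq with hen | hen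
      · have := (h.splitAt ⟨e, hen⟩ (Finset.mem_compl.1 (hb.right_mem ⟨e, hen⟩ rfl)) q).1 hqe
        exact this
      · have := (r.1 q).isLt
        omega
    | succ k ih =>
      intro q hq hqe
      have hpq := prev_val q
      have h1 := hstep q (by omega) hqe
      have h2 := ih (prev q) (by omega) (by omega)
      omega
  have hlower : ∀ k, ∀ q : Fin n, q.val + k + 1 = e → o.val ≤ q.val →
      o.val + 1 + k ≤ (r.1 q).val := by
    intro k
    induction k with
    | zero => exact fun q _ hoq => hlow q hoq
    | succ k ih =>
      intro q hq hoq
      have hqn : q.val + 1 < n := by have := hb.le; omega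
      have h1 := hstep ⟨q.val + 1, hqn⟩ (Nat.lt_succ_of_le hoq) (by dsimp only; omega)
      have h2 := ih ⟨q.val + 1, hqn⟩ (by dsimp only; omega) (Nat.le_succ_of_le hoq)
      have h3 : prev ⟨q.val + 1, hqn⟩ = q := Fin.ext (by rw [prev_val]; rfl)
      rw [h3] at h1
      omega
  rw [Fin.le_def] at hop
  have h1 := hupper (p.val - o.val) p (by omega) hpe
  have h2 := hlower (e - 1 - p.val) p (by omega) hop
  omega

theorem apply_eq_succ_iff (h : IsSortedBy S r) (a b : Fin n) :
    r.1 b = a.succ ↔ ∃ o e, IsBlock Sᶜ o e ∧ o ≤ a ∧ o ≤ b ∧ a.val + b.val + 1 = o.val + e := by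
  rw [Fin.ext_iff, Fin.val_succ]
  constructor
  · intro hab
    have : ∃ i ∈ Sᶜ, i ≤ b := by
      by_contra! hS
      have := h.eq_zero b.val b rfl fun i hi => by
        by_contra hiS
        exact absurd hi (not_le.2 (hS i (Finset.mem_compl.2 hiS)))
      omega
    obtain ⟨i, hi, hib⟩ := this
    obtain ⟨o, e, hoe, hob, hbe⟩ := exists_isBlock hi hib
    have := h.val_add hoe hob hbe
    refine ⟨o, e, hoe, ?_, hob, by omega⟩
    rw [Fin.le_def]
    omega
  · rintro ⟨o, e, hoe, hoa, hob, hab⟩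
    rw [Fin.le_def] at hoa
    have := h.val_add hoe hob (by omega)
    omega

end IsSortedBy

theorem toMatrix_injective : Function.Injective (toMatrix : Rook n → _) := by
  intro r s h
  have key : ∀ b a : Fin n, r.1 b = a.succ ↔ s.1 b = a.succ := fun b a => by
    have := congrFun (congrFun h a) b
    simp only [toMatrix, Matrix.of_apply] at this
    split_ifs at this <;> simp_all
  refine Subtype.ext (funext fun b => ?_)
  rcases Fin.eq_zero_or_eq_succ (r.1 b) with hr | ⟨a, ha⟩
  · rcases Fin.eq_zero_or_eq_succ (s.1 b) with hs | ⟨a, ha⟩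
    · rw [hr, hs]
    · rw [ha, (key b a).2 ha]
  · rw [ha, (key b a).1 ha]

end Rook

/-! ### Blocks of an extended composition -/

/-- The partial sums of the differences of a monotone list telescope. -/
theorem List.sum_take_zipWith_sub_add (m : ℕ) (t : List ℕ) (c : ℕ) (h : (c :: t).Pairwise (· ≤ ·))
    (k : ℕ) (hk : k < (c :: t).length) :
    ((List.zipWith (fun b a => b - a) (t ++ [m]) (c :: t)).take k).sum + c = (c :: t)[k] := by
  induction t generalizing c k with
  | nil =>
    obtain rfl : k = 0 := by simpa using hk
    simp
  | cons d t ih =>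
    cases k with
    | zero => simp
    | succ k =>
      have hcd : c ≤ d := (List.pairwise_cons.1 h).1 d (by simp)
      have := ih d (List.pairwise_cons.1 h).2 k (by simpa using hk)
      simp only [List.cons_append, List.zipWith_cons_cons, List.take_succ_cons, List.sum_cons,
        List.getElem_cons_succ]
      omega

open Rook in
/-- The nonzero entries of the block matrix of `extComposition T`, in terms of the blocks of `T`. -/
theorem antiBlockMatrix_extComposition_apply {n : ℕ} (T : Finset (Fin n)) (a b : Fin n) :
    antiBlockMatrix n (extComposition T) a b = open Classical in
      if ∃ o e, IsBlock T o e ∧ o ≤ a ∧ o ≤ b ∧ a.val + b.val + 1 = o.val + e then 1 else 0 := by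
  classical
  set s : List (Fin n) := T.sort (· ≤ ·) with hs
  have hmem : ∀ i, i ∈ s ↔ i ∈ T := fun i => Finset.mem_sort _
  have hmono : ∀ (j k : ℕ) (hj : j < s.length) (hk : k < s.length), j < k →
      (s[j]).val < (s[k]).val := fun j k hj hk hjk =>
    Fin.lt_def.1 (List.pairwise_iff_getElem.1 (Finset.sortedLT_sort T).pairwise j k hj hk hjk)
  have hlen : (extComposition T).length = s.length + 1 := by
    simp [extComposition, hs]
  have hpw : (0 :: s.map Fin.val).Pairwise (· ≤ ·) := by
    refine List.pairwise_cons.2 ⟨fun _ _ => Nat.zero_le _, List.pairwise_map.2 ?_⟩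
    exact (Finset.sortedLT_sort T).pairwise.imp fun h => le_of_lt h
  have hsum : ∀ (j : ℕ) (hj : j < s.length),
      ((extComposition T).take (j + 1)).sum = (s[j]).val := by
    intro j hj
    have := List.sum_take_zipWith_sub_add n _ 0 hpw (j + 1) (by simpa using hj)
    simpa [extComposition, ← hs] using this
  have hget : ∀ (j : ℕ) (hj : j < s.length) (hj' : j + 1 < (extComposition T).length),
      (extComposition T)[j + 1] =
        (if h : j + 1 < s.length then (s[j + 1]).val else n) - (s[j]).val := by
    intro j hj hj'
    simp only [extComposition, ← hs, List.getElem_zipWith, List.getElem_cons_succ,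
      List.getElem_map, List.getElem_append, List.length_map]
    split_ifs with h <;> simp
  -- the block starting at the `j`-th element of `T` ends at the next element of `T`, or at `n`
  have hblock : ∀ (j : ℕ) (hj : j < s.length) (e : ℕ),
      IsBlock T s[j] e ↔ e = if h : j + 1 < s.length then (s[j + 1]).val else n := by
    have hex : ∀ (j : ℕ) (hj : j < s.length),
        IsBlock T s[j] (if h : j + 1 < s.length then (s[j + 1]).val else n) := by
      intro j hj
      refine ⟨(hmem _).1 (List.getElem_mem hj), ?_, ?_, fun i hi => ?_, fun i hji hi hiT => ?_⟩
      · split_ifs with h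
        · exact hmono j (j + 1) hj h (Nat.lt_succ_self j)
        · exact (s[j]).isLt
      · split_ifs with h
        · exact (s[j + 1]).isLt.le
        · exact le_rfl
      · split_ifs at hi with h
        · rw [Fin.ext hi]
          exact (hmem _).1 (List.getElem_mem h)
        · exact absurd hi i.isLt.ne
      · obtain ⟨k, hk, rfl⟩ := List.getElem_of_mem ((hmem i).2 hiT)
        have hjk : j < k := by
          by_contra! hkj
          rcases hkj.lt_or_eq with hkj | rfl
          · have := hmono k j hk hj hkj
            omega
          · omega
        have h : j + 1 < s.length := by omega
        rw [dif_pos h] at hi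
        rcases (Nat.succ_le_of_lt hjk).lt_or_eq with h' | h'
        · have := hmono (j + 1) k h hk h'
          omega
        · subst h'
          exact lt_irrefl _ hi
    have huniq : ∀ {o : Fin n} {e e' : ℕ}, IsBlock T o e → IsBlock T o e' → ¬ e < e' := by
      intro o e e' h h' hlt
      have hen : e < n := hlt.trans_le h'.le
      exact h'.notMem ⟨e, hen⟩ h.lt hlt (h.right_mem ⟨e, hen⟩ rfl)
    intro j hj e
    refine ⟨fun h => ?_, fun h => h ▸ hex j hj⟩
    exact le_antisymm (not_lt.1 (huniq (hex j hj) h)) (not_lt.1 (huniq h (hex j hj)))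
  unfold antiBlockMatrix
  rw [Matrix.of_apply]
  refine if_congr ?_ rfl rfl
  constructor
  · rintro ⟨⟨k, hk⟩, hk0, hka, hkb, hab⟩
    obtain ⟨j, rfl⟩ := Nat.exists_eq_succ_of_ne_zero hk0
    have hj : j < s.length := by omega
    have hB := (hblock j hj _).2 rfl
    simp only [Nat.succ_eq_add_one, List.get_eq_getElem] at hka hkb hab
    rw [hsum j hj] at hka hkb hab
    rw [hget j hj] at hab
    have := hB.lt
    exact ⟨s[j], _, hB, hka, hkb, by omega⟩
  · rintro ⟨o, e, hoe, hoa, hob, hab⟩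
    obtain ⟨j, hj, rfl⟩ := List.getElem_of_mem ((hmem o).2 hoe.left_mem)
    refine ⟨⟨j + 1, by omega⟩, Nat.succ_ne_zero j, ?_, ?_, ?_⟩
    · rw [hsum j hj]
      exact hoa
    · rw [hsum j hj]
      exact hob
    · rw [hsum j hj, List.get_eq_getElem, hget j hj, ← (hblock j hj e).1 hoe]
      have := hoe.lt
      omega

theorem Rook.IsSortedBy.toMatrix_eq {n : ℕ} {S : Finset (Fin n)} {r : Rook n}
    (h : r.IsSortedBy S) : r.toMatrix = antiBlockMatrix n (extComposition Sᶜ) := by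
  classical
  ext a b
  rw [antiBlockMatrix_extComposition_apply, toMatrix, Matrix.of_apply]
  exact if_congr (h.apply_eq_succ_iff a b) rfl rfl

/-! ### Zeros of parabolic submonoids and idempotents -/

namespace ZeroRookMonoid

variable {n : ℕ}

theorem splitAt_act {S : Finset (Fin n)} {i : Fin n} (hi : i ∉ S) {x : ZeroRookMonoid n}
    (hx : x ∈ parabolic S) : (act (Rook.one n) x).SplitAt i := by
  suffices ∀ r : Rook n, r.SplitAt i → (act r x).SplitAt i from this _ (Rook.splitAt_one i)
  induction hx using Submonoid.closure_induction with
  | mem x hx =>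
    obtain ⟨j, hj, rfl⟩ := hx
    exact fun r hr => hr.pi (by rintro rfl; exact hi hj)
  | one => exact fun r hr => hr
  | mul x y _ _ hx hy => exact fun r hr => hy _ (hx r hr)

theorem isSortedBy_act {S : Finset (Fin n)} {z : ZeroRookMonoid n} (hz : z ∈ parabolic S)
    (hfix : ∀ i ∈ S, z * gen i = z) : (act (Rook.one n) z).IsSortedBy S where
  splitAt _ hi := splitAt_act hi hz
  fixed i hi := by rw [← act_gen, ← act_mul, hfix i hi]

theorem eq_of_toMatrix_eq {x y : ZeroRookMonoid n}
    (h : (act (Rook.one n) x).toMatrix = (act (Rook.one n) y).toMatrix) : x = y :=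
  act_one_injective (Rook.toMatrix_injective h)

/-- Right-fixed elements of a parabolic submonoid are two-sided zeros: `x * z` is again right-fixed,
and the rook determines a right-fixed element uniquely. -/
theorem isZeroOf_of_right_fixed {S : Finset (Fin n)} {z : ZeroRookMonoid n} (hz : z ∈ parabolic S)
    (hfix : ∀ i ∈ S, z * gen i = z) : IsZeroOf (parabolic S) z := by
  refine ⟨hz, fun x hx => ⟨?_, mul_eq_of_mem_parabolic hfix hx⟩⟩
  refine eq_of_toMatrix_eq ?_
  rw [(isSortedBy_act hz hfix).toMatrix_eq]
  exact (isSortedBy_act (mul_mem hx hz) fun i hi => by rw [mul_assoc, hfix i hi]).toMatrix_eq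

theorem gen_mem_parabolic {S : Finset (Fin n)} {i : Fin n} (hi : i ∈ S) : gen i ∈ parabolic S :=
  Submonoid.subset_closure ⟨i, hi, rfl⟩

theorem mul_gen_eq_iff {S : Finset (Fin n)} {z : ZeroRookMonoid n}
    (hz : IsZeroOf (parabolic S) z) (i : Fin n) : z * gen i = z ↔ i ∈ S := by
  refine ⟨fun h => ?_, fun hi => (hz.2 _ (gen_mem_parabolic hi)).2⟩
  by_contra hi
  refine (splitAt_act hi hz.1).pi_ne ?_
  rw [← act_gen, ← act_mul, h]

/-- An idempotent `e` is the zero of the parabolic submonoid of the generators that fix it on the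
right: by `R`-triviality that submonoid contains `e`, so its zero `z` satisfies `e = e * z = z`. -/
theorem exists_isZeroOf_of_isIdempotentElem {e : ZeroRookMonoid n} (he : IsIdempotentElem e) :
    ∃ S, IsZeroOf (parabolic S) e := by
  classical
  obtain ⟨z, hz, hfix⟩ := exists_right_fixed (Finset.univ.filter fun i => e * gen i = e)
  have hzero := isZeroOf_of_right_fixed hz hfix
  have hmem : e ∈ parabolic (Finset.univ.filter fun i => e * gen i = e) :=
    mem_parabolic_of_mul_eq (fun i hi => by simpa using hi) he
  have h1 : e * z = e := mul_eq_of_mem_parabolic (fun i hi => by simpa using hi) hz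
  have h2 : e = z := h1.symm.trans (hzero.2 e hmem).1
  exact ⟨Finset.univ.filter fun i => e * gen i = e, by rwa [← h2] at hzero⟩

end ZeroRookMonoid

theorem mainTheorem6 (n : ℕ) :
    {e : ZeroRookMonoid n | IsIdempotentElem e}.ncard = 2 ^ n ∧
    ∃ z : Finset (Fin n) → ZeroRookMonoid n,
      (∀ (S : Finset (Fin n)) (x : ZeroRookMonoid n),
        IsZeroOf (ZeroRookMonoid.parabolic S) x ↔ x = z S) ∧
      {e : ZeroRookMonoid n | IsIdempotentElem e} = Set.range z ∧
      (∀ S : Finset (Fin n),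
        (ZeroRookMonoid.act (Rook.one n) (z S)).toMatrix =
          antiBlockMatrix n (extComposition Sᶜ)) ∧
      (∀ (S : Finset (Fin n)) (x : ZeroRookMonoid n),
        (ZeroRookMonoid.act (Rook.one n) x).toMatrix =
          antiBlockMatrix n (extComposition Sᶜ) → x = z S) := by
  choose z hz hfix using ZeroRookMonoid.exists_right_fixed (n := n)
  have hzero : ∀ S, IsZeroOf (ZeroRookMonoid.parabolic S) (z S) := fun S =>
    ZeroRookMonoid.isZeroOf_of_right_fixed (hz S) (hfix S)
  have hiff : ∀ S x, IsZeroOf (ZeroRookMonoid.parabolic S) x ↔ x = z S := fun S x =>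
    ⟨fun hx => (hx.2 _ (hz S)).2.symm.trans ((hzero S).2 x hx.1).1, fun hx => hx ▸ hzero S⟩
  have hinj : Function.Injective z := fun S T hST => by
    ext i
    rw [← ZeroRookMonoid.mul_gen_eq_iff (hzero S), hST, ZeroRookMonoid.mul_gen_eq_iff (hzero T)]
  have hidem : {e : ZeroRookMonoid n | IsIdempotentElem e} = Set.range z := by
    ext e
    constructor
    · intro he
      obtain ⟨S, hS⟩ := ZeroRookMonoid.exists_isZeroOf_of_isIdempotentElem he
      exact ⟨S, ((hiff S e).1 hS).symm⟩
    · rintro ⟨S, rfl⟩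
      exact ((hzero S).2 _ (hz S)).1
  have hmat : ∀ S, (ZeroRookMonoid.act (Rook.one n) (z S)).toMatrix =
      antiBlockMatrix n (extComposition Sᶜ) :=
    fun S => (ZeroRookMonoid.isSortedBy_act (hz S) (hfix S)).toMatrix_eq
  refine ⟨?_, z, hiff, hidem, hmat, fun S x hx =>
    ZeroRookMonoid.eq_of_toMatrix_eq (hx.trans (hmat S).symm)⟩
  rw [hidem, ← Set.image_univ, Set.ncard_image_of_injective _ hinj, Set.ncard_univ]
  simp
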